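/- Let $(X_n)_{n\ge1}$ be a sequence of real random variables on a measurable space $(\Omega,\mathcal F)$ and fix $\theta\in\mathbb R$, $\delta>0$, $C>0$, $\rho>0$. Put $\overline X_n=\frac1n\sum_{i\le n}X_i$, $\hat s_n^2=\frac1n\sum_{i\le n}(X_i-\overline X_n)^2$, $S_n(\theta)=\sum_{i\le n}(X_i-\theta)$, $\hat u_n=n\left(\hat s_n^2+\frac1{\log n}\right)$ and $$E_n=\min\left\{\frac{1}{\sqrt{\rho\hat u_n+1}}\exp\left(\frac{\rho\,S_n(\theta)^2}{2\rho\hat u_n+2}\right),\ C\,n^{0.24\,\delta}\right\}.$$ Let $\mathcal M_{2+\delta}(\theta)$ be the set of probability measures $P$ on $(\Omega,\mathcal F)$ under which $(X_n)$ is iid with $\mathbb E_P[X_1]=\theta$ and $\mathbb E_P|X_1-\theta|^{2+\delta}<\infty$. Then: 1. $E_n$ is the truncated mixture over the centered Gaussian with variance $\rho$: for $n\ge2$, $E_n=\min\left\{\int_{\mathbb R}\exp\left(\lambda S_n(\theta)-n\left(\hat s_n^2+\tfrac1{\log n}\right)\tfrac{\lambda^2}{2}\right)dN(0,\rho)(\lambda),\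 C\,n^{0.24\,\delta}\right\}$. 2. $(E_n)$ is an asymptotic e-variable for $\mathcal M_{2+\delta}(\theta)$, that is, a sequence of nonnegative random variables with $\sup_{P\in\mathcal M_{2+\delta}(\theta)}\limsup_{n\to\infty}\mathbb E_P[E_n]\le1$. 3. For every $\mathcal P\subseteq\mathcal M_{2+\delta}(\theta)$ with $\sup_{P\in\mathcal P}\mathbb E_P|X_1|^{2+\delta}<\infty$, $(E_n)$ is a $\mathcal P$-uniform asymptotic e-variable, that is, $\limsup_{n\to\infty}\sup_{P\in\mathcal P}\mathbb E_P[E_n]\le1$. -/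

import Mathlib

open MeasureTheory ProbabilityTheory Filter
open scoped ENNReal

noncomputable section

/-- The class of probability measures on `ℝ` with mean `θ` and a finite `q`-th moment (`q ≥ 1`). -/
def momentClass (q θ : ℝ) : Set (Measure ℝ) :=
  {Q | IsProbabilityMeasure Q ∧ Integrable (fun x : ℝ => |x - θ| ^ q) Q ∧ ∫ x, x ∂Q = θ}

/-- The probability measures `P` on `Ω` under which `X 0, X 1, …` are independent and identically
distributed, with common law in `M`. -/
def iidLaws {Ω : Type*} [MeasurableSpace Ω] (X : ℕ → Ω → ℝ) (M : Set (Measure ℝ)) :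
    Set (Measure Ω) :=
  {P | IsProbabilityMeasure P ∧ iIndepFun X P ∧ (∀ i, IdentDistrib (X i) (X 0) P P) ∧
    P.map (X 0) ∈ M}

/-- `sup_{P ∈ Ps} E_P |Y|^q < ∞`. -/
def UniformlyBoundedMoment {Ω : Type*} [MeasurableSpace Ω] (Ps : Set (Measure Ω)) (Y : Ω → ℝ)
    (q : ℝ) : Prop :=
  (⨆ P ∈ Ps, ∫⁻ ω, ENNReal.ofReal (|Y ω| ^ q) ∂P) < ∞

/-- `(E_n)` is an asymptotic e-variable for `Ps`: the `E_n` are nonnegative random variables with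
`sup_{P ∈ Ps} limsup_n E_P[E_n] ≤ 1`. -/
def IsAsymptoticEVariable {Ω : Type*} [MeasurableSpace Ω] (Ps : Set (Measure Ω))
    (E : ℕ → Ω → ℝ) : Prop :=
  (∀ n, Measurable (E n)) ∧ (∀ n ω, 0 ≤ E n ω) ∧
    (⨆ P ∈ Ps, limsup (fun n => ∫⁻ ω, ENNReal.ofReal (E n ω) ∂P) atTop) ≤ 1

/-- `(E_n)` is a `Ps`-uniform asymptotic e-variable: the `E_n` are nonnegative random variables with
`limsup_n sup_{P ∈ Ps} E_P[E_n] ≤ 1`. -/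
def IsUniformAsymptoticEVariable {Ω : Type*} [MeasurableSpace Ω] (Ps : Set (Measure Ω))
    (E : ℕ → Ω → ℝ) : Prop :=
  (∀ n, Measurable (E n)) ∧ (∀ n ω, 0 ≤ E n ω) ∧
    limsup (fun n => ⨆ P ∈ Ps, ∫⁻ ω, ENNReal.ofReal (E n ω) ∂P) atTop ≤ 1

/-- The mean of the first `n` observations `X 0, …, X (n - 1)`. -/
def sampleMean {Ω : Type*} (X : ℕ → Ω → ℝ) (n : ℕ) (ω : Ω) : ℝ :=
  (∑ i ∈ Finset.range n, X i ω) / n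

/-- The biased sample variance of the first `n` observations. -/
def sampleVar {Ω : Type*} (X : ℕ → Ω → ℝ) (n : ℕ) (ω : Ω) : ℝ :=
  (∑ i ∈ Finset.range n, (X i ω - sampleMean X n ω) ^ 2) / n

/-- The centered sum `S_n(θ)` of the first `n` observations. -/
def centeredSum {Ω : Type*} (X : ℕ → Ω → ℝ) (θ : ℝ) (n : ℕ) (ω : Ω) : ℝ :=
  ∑ i ∈ Finset.range n, (X i ω - θ)

/-- The regularized variance process `û_n = n (ŝ_n² + 1 / log n)`. -/
def regVar {Ω : Type*} (X : ℕ → Ω → ℝ) (n : ℕ) (ω : Ω) : ℝ :=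
  n * (sampleVar X n ω + (Real.log n)⁻¹)

/-- The mixture `(∫ exp (λ S_n(θ) - n (ŝ_n² + ε_n) λ² / 2) dF(λ)) ∧ T_n`, for a mixing
distribution `F` on `ℝ`. -/
def rwsMixture {Ω : Type*} (X : ℕ → Ω → ℝ) (θ : ℝ) (F : Measure ℝ) (ε T : ℕ → ℝ)
    (n : ℕ) (ω : Ω) : ℝ :=
  min (∫ l, Real.exp (l * centeredSum X θ n ω - n * (sampleVar X n ω + ε n) * (l ^ 2 / 2)) ∂F)
    (T n)

/-- The truncated process
`((ρ û_n + 1) ^ (-1/2) * exp (ρ S_n(θ)² / (2 ρ û_n + 2))) ∧ C n ^ (0.24 δ)`. -/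
def rwsNormalMixture {Ω : Type*} (X : ℕ → Ω → ℝ) (θ ρ C δ : ℝ) (n : ℕ) (ω : Ω) : ℝ :=
  min (1 / √(ρ * regVar X n ω + 1) *
      Real.exp (ρ * centeredSum X θ n ω ^ 2 / (2 * ρ * regVar X n ω + 2)))
    (C * (n : ℝ) ^ (δ * 0.24))

end

/-!
Write `Y_i = X_i - θ`, `S_n = ∑ Y_i`, `V_n² = ∑ Y_i²` and `σ² = E Y_0²`. The closed form of the
mixture is a Gaussian integral, computed by completing the square.

For the expectation, the inequality `exp (x - x²/6) ≤ 1 + x + x²/3` gives, with two moments only,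
`E exp (l S_n - l² (V_n² + 2 n σ²) / 6) ≤ 1` for every real `l`
(`lintegral_exp_selfNormalized_le_one`). By Tonelli the Gaussian mixture of these exponentials also
has expectation at most one. It dominates the mixture that defines `E_n` on the event
`û_n ≥ (V_n² + 2 n σ²) / 3`, so that `E[E_n] ≤ 1 + T_n P(û_n < (V_n² + 2 n σ²) / 3)` with the
truncation level `T_n = C n ^ (0.24 δ)` (`lintegral_rwsNormalMixture_le`).

On the exceptional event, up to constants, either `V_n²` is smaller than `n σ²` by `n / log n`, or
`|S_n|` exceeds `n / √(log n)` (`exceptional_subset`). The first is a lower deviation of a sum of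
nonnegative variables with a moment of order above one, and has probability
`exp (-n ^ (1/2 - o(1)))` (`measure_sumSq_le`). For the second, either some `|Y_i|` exceeds `n ^ β`,
with probability `O(n ^ (-δ/4))` for a suitable `β < 1/2`, or `V_n² ≤ n ^ (1 + 2β)`, and then the
self-normalized inequality itself gives a stretched exponential bound
(`measure_mul_sum_ge_and_sumSq_le`). All these bounds depend on the law only through a bound on the
centered moment of order `2 + δ`, and since `0.24 < 1/4` they are `o(1 / T_n)`. This is the uniform
statement, and the pointwise one is its case of a single law.
-/

/-! ### Elementary inequalities for the exponential -/

/-- The function `(1 + x + x²/3) exp (x²/6 - x)` has derivative `x³/9 * exp (x²/6 - x)`, hence its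
minimum is its value `1` at `x = 0`. -/
lemma exp_sub_sq_div_six_le (x : ℝ) : Real.exp (x - x ^ 2 / 6) ≤ 1 + x + x ^ 2 / 3 := by
  set h : ℝ → ℝ := fun y => (1 + y + y ^ 2 / 3) * Real.exp (y ^ 2 / 6 - y) with hh
  have hd : ∀ y, HasDerivAt h (y ^ 3 / 9 * Real.exp (y ^ 2 / 6 - y)) y := by
    intro y
    have h1 : HasDerivAt (fun y : ℝ => 1 + y + y ^ 2 / 3) (1 + 2 * y / 3) y := by
      have := ((hasDerivAt_id y).const_add 1).add ((hasDerivAt_pow 2 y).div_const 3)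
      refine this.congr_deriv ?_
      norm_num
    have h2 : HasDerivAt (fun y : ℝ => y ^ 2 / 6 - y) (y / 3 - 1) y := by
      have := ((hasDerivAt_pow 2 y).div_const 6).sub (hasDerivAt_id y)
      refine this.congr_deriv ?_
      norm_num
      ring
    refine (h1.mul h2.exp).congr_deriv ?_
    ring
  have hc : Continuous h := continuous_iff_continuousAt.2 fun y => (hd y).continuousAt
  have hmin : 1 ≤ h x := by
    have h0 : h 0 = 1 := by simp [hh]
    rw [← h0]
    rcases le_total 0 x with hx | hx
    · refine monotoneOn_of_deriv_nonneg (convex_Ici 0) hc.continuousOn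
        (fun y _ => (hd y).differentiableAt.differentiableWithinAt) ?_
        (Set.mem_Ici.2 le_rfl) (Set.mem_Ici.2 hx) hx
      intro y hy
      rw [interior_Ici, Set.mem_Ioi] at hy
      rw [(hd y).deriv]
      positivity
    · refine antitoneOn_of_deriv_nonpos (convex_Iic 0) hc.continuousOn
        (fun y _ => (hd y).differentiableAt.differentiableWithinAt) ?_
        (Set.mem_Iic.2 hx) (Set.mem_Iic.2 le_rfl) hx
      intro y hy
      rw [interior_Iic, Set.mem_Iio] at hy
      rw [(hd y).deriv]
      have : y ^ 3 ≤ 0 := (Odd.pow_nonpos_iff (by decide)).2 hy.le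
      exact mul_nonpos_of_nonpos_of_nonneg (by linarith) (Real.exp_nonneg _)
  have h3 : Real.exp (x - x ^ 2 / 6) * Real.exp (x ^ 2 / 6 - x) = 1 := by
    rw [← Real.exp_add]
    simp
  have h4 := Real.exp_pos (x - x ^ 2 / 6)
  calc Real.exp (x - x ^ 2 / 6) = Real.exp (x - x ^ 2 / 6) * 1 := (mul_one _).symm
    _ ≤ Real.exp (x - x ^ 2 / 6) * h x := by gcongr
    _ = (1 + x + x ^ 2 / 3) * (Real.exp (x - x ^ 2 / 6) * Real.exp (x ^ 2 / 6 - x)) := by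
      simp only [hh]; ring
    _ = _ := by rw [h3, mul_one]

lemma exp_neg_le_one_sub_add_rpow {a x : ℝ} (ha : 0 < a) (ha1 : a ≤ 1) (hx : 0 ≤ x) :
    Real.exp (-x) ≤ 1 - x + x ^ (1 + a) := by
  rcases le_total x 1 with h | h
  · have h1 := (abs_le.1 (Real.abs_exp_sub_one_sub_id_le (x := -x)
      (by rwa [abs_neg, abs_of_nonneg hx]))).2
    have h2 : x ^ (2 : ℝ) ≤ x ^ (1 + a) :=
      Real.rpow_le_rpow_of_exponent_ge' hx h (by linarith) (by linarith)
    rw [Real.rpow_two] at h2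
    nlinarith
  · have h1 : Real.exp (-x) ≤ 1 := Real.exp_le_one_iff.2 (by linarith)
    have h2 : x ^ (1 : ℝ) ≤ x ^ (1 + a) := Real.rpow_le_rpow_of_exponent_le h (by linarith)
    rw [Real.rpow_one] at h2
    linarith

/-! ### The Gaussian mixture -/

/-- Completing the square turns the tilted Gaussian density into a multiple of the density of
`N(ρ s / (ρ u + 1), ρ / (ρ u + 1))`. -/
lemma integral_exp_gaussianReal {ρ u : ℝ} (hρ : 0 < ρ) (hu : 0 ≤ u) (s : ℝ) :
    ∫ l, Real.exp (l * s - u * (l ^ 2 / 2)) ∂(gaussianReal 0 ρ.toNNReal) =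
      1 / √(ρ * u + 1) * Real.exp (ρ * s ^ 2 / (2 * ρ * u + 2)) := by
  have hd : 0 < ρ * u + 1 := by positivity
  have hv : 0 < ρ / (ρ * u + 1) := by positivity
  have h0 : ρ.toNNReal ≠ 0 := by simpa using hρ
  rw [integral_gaussianReal_eq_integral_smul h0]
  have key : ∀ l : ℝ, gaussianPDFReal 0 ρ.toNNReal l • Real.exp (l * s - u * (l ^ 2 / 2)) =
      (1 / √(ρ * u + 1) * Real.exp (ρ * s ^ 2 / (2 * ρ * u + 2))) *
        gaussianPDFReal (ρ * s / (ρ * u + 1)) (ρ / (ρ * u + 1)).toNNReal l := by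
    intro l
    simp only [gaussianPDFReal, smul_eq_mul, Real.coe_toNNReal _ hρ.le, Real.coe_toNNReal _ hv.le]
    have e1 : √(2 * Real.pi * (ρ / (ρ * u + 1))) = √(2 * Real.pi * ρ) / √(ρ * u + 1) := by
      rw [← Real.sqrt_div' _ hd.le, mul_div_assoc]
    have e2 : (√(ρ * u + 1)) ≠ 0 := (Real.sqrt_pos.2 hd).ne'
    have e3 : (√(2 * Real.pi * ρ)) ≠ 0 := (Real.sqrt_pos.2 (by positivity)).ne'
    rw [e1, mul_assoc, ← Real.exp_add]
    have e4 : ∀ A B c d : ℝ, c ≠ 0 → d ≠ 0 →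
        1 / c * A * ((d / c)⁻¹ * B) = d⁻¹ * (A * B) := by
      intro A B c d hc hd'
      field_simp
    rw [e4 _ _ _ _ e2 e3, ← Real.exp_add]
    congr 2
    have : 2 * ρ * u + 2 ≠ 0 := by positivity
    field_simp
    ring
  simp_rw [key]
  rw [integral_const_mul, integral_gaussianPDFReal_eq_one _ (by simpa using hv), mul_one]

/-! ### Exponential inequalities for sums of independent identically distributed variables -/

lemma measure_le_of_lintegral_exp_le {Ω : Type*} [MeasurableSpace Ω] {P : Measure Ω} {f : Ω → ℝ}
    (hf : Measurable f) {B : ℝ} (hB : ∫⁻ ω, ENNReal.ofReal (Real.exp (f ω)) ∂P ≤ ENNReal.ofReal B)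
    (c : ℝ) : P {ω | c ≤ f ω} ≤ ENNReal.ofReal (Real.exp (-c) * B) := by
  have h1 := mul_meas_ge_le_lintegral₀ (μ := P) (f := fun ω => ENNReal.ofReal (Real.exp (f ω)))
    (by fun_prop) (ENNReal.ofReal (Real.exp c))
  have h2 : {ω | c ≤ f ω} ⊆
      {ω | ENNReal.ofReal (Real.exp c) ≤ ENNReal.ofReal (Real.exp (f ω))} := fun ω hω =>
    ENNReal.ofReal_le_ofReal (Real.exp_le_exp.2 hω)
  calc P {ω | c ≤ f ω}
      = ENNReal.ofReal (Real.exp (-c)) * (ENNReal.ofReal (Real.exp c) * P {ω | c ≤ f ω}) := by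
        rw [← mul_assoc, ← ENNReal.ofReal_mul (Real.exp_nonneg _), ← Real.exp_add]
        simp
    _ ≤ ENNReal.ofReal (Real.exp (-c)) * ENNReal.ofReal B := by
        gcongr
        exact ((mul_le_mul_right (measure_mono h2) _).trans h1).trans hB
    _ = _ := (ENNReal.ofReal_mul (Real.exp_nonneg _)).symm

section Iid

variable {Ω : Type*} [MeasurableSpace Ω] {P : Measure Ω} {Y : ℕ → Ω → ℝ}

lemma lintegral_prod_comp_eq_pow (hY : ∀ i, Measurable (Y i)) (hind : iIndepFun Y P)
    (hid : ∀ i, IdentDistrib (Y i) (Y 0) P P) {g : ℝ → ℝ≥0∞} (hg : Measurable g) (n : ℕ) :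
    ∫⁻ ω, ∏ i ∈ Finset.range n, g (Y i ω) ∂P = (∫⁻ ω, g (Y 0 ω) ∂P) ^ n := by
  have h := lintegral_prod_eq_prod_lintegral_of_indepFun (Finset.range n) (fun i ω => g (Y i ω))
    (hind.comp (fun _ => g) fun _ => hg) fun i => hg.comp (hY i)
  rw [h]
  have : ∀ i, ∫⁻ ω, g (Y i ω) ∂P = ∫⁻ ω, g (Y 0 ω) ∂P := fun i =>
    ((hid i).comp hg).lintegral_eq
  simp [this]

lemma lintegral_exp_sum_le_one (hY : ∀ i, Measurable (Y i)) (hind : iIndepFun Y P)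
    (hid : ∀ i, IdentDistrib (Y i) (Y 0) P P) {g : ℝ → ℝ} (hg : Measurable g)
    (h : ∫⁻ ω, ENNReal.ofReal (Real.exp (g (Y 0 ω))) ∂P ≤ 1) (n : ℕ) :
    ∫⁻ ω, ENNReal.ofReal (Real.exp (∑ i ∈ Finset.range n, g (Y i ω))) ∂P ≤ 1 := by
  calc ∫⁻ ω, ENNReal.ofReal (Real.exp (∑ i ∈ Finset.range n, g (Y i ω))) ∂P
      = ∫⁻ ω, ∏ i ∈ Finset.range n, ENNReal.ofReal (Real.exp (g (Y i ω))) ∂P := by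
        congr with ω
        rw [Real.exp_sum, ENNReal.ofReal_prod_of_nonneg fun i _ => Real.exp_nonneg _]
    _ = (∫⁻ ω, ENNReal.ofReal (Real.exp (g (Y 0 ω))) ∂P) ^ n :=
        lintegral_prod_comp_eq_pow (g := fun y => ENNReal.ofReal (Real.exp (g y))) hY hind hid
          (by fun_prop) n
    _ ≤ 1 := pow_le_one₀ zero_le h

/-- The self-normalized exponential inequality. It holds for every real `l` without any
exponential moment, because `∑ Y i ^ 2` compensates the tails of `∑ Y i`. -/
lemma lintegral_exp_selfNormalized_le_one (hY : ∀ i, Measurable (Y i)) (hind : iIndepFun Y P)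
    (hid : ∀ i, IdentDistrib (Y i) (Y 0) P P) (hint : Integrable (Y 0) P)
    (hmean : ∫ ω, Y 0 ω ∂P = 0) (hsq : Integrable (fun ω => Y 0 ω ^ 2) P) (l : ℝ) (n : ℕ) :
    ∫⁻ ω, ENNReal.ofReal (Real.exp (l * ∑ i ∈ Finset.range n, Y i ω -
      l ^ 2 * (∑ i ∈ Finset.range n, Y i ω ^ 2 + 2 * n * ∫ ω, Y 0 ω ^ 2 ∂P) / 6)) ∂P ≤ 1 := by
  have : IsProbabilityMeasure P := hind.isProbabilityMeasure
  set v := ∫ ω, Y 0 ω ^ 2 ∂P with hv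
  have h := lintegral_exp_sum_le_one hY hind hid
    (g := fun y => (l * y - (l * y) ^ 2 / 6) - l ^ 2 * v / 3) (by fun_prop) ?_ n
  · convert h using 5 with ω
    simp only [Finset.sum_sub_distrib, Finset.mul_sum, Finset.sum_const, Finset.card_range,
      nsmul_eq_mul, mul_pow, ← Finset.sum_div]
    simp only [← Finset.mul_sum]
    ring
  · have hi : Integrable (fun ω => (1 + l * Y 0 ω + (l * Y 0 ω) ^ 2 / 3) *
        Real.exp (-(l ^ 2 * v / 3))) P := by
      simp only [mul_pow]
      exact (((integrable_const 1).add (hint.const_mul l)).add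
        ((hsq.const_mul (l ^ 2)).div_const 3)).mul_const _
    have hle : ∀ ω, Real.exp ((l * Y 0 ω - (l * Y 0 ω) ^ 2 / 6) - l ^ 2 * v / 3) ≤
        (1 + l * Y 0 ω + (l * Y 0 ω) ^ 2 / 3) * Real.exp (-(l ^ 2 * v / 3)) := fun ω => by
      rw [sub_eq_add_neg, Real.exp_add]
      gcongr
      exact exp_sub_sq_div_six_le _
    calc _ ≤ ∫⁻ ω, ENNReal.ofReal ((1 + l * Y 0 ω + (l * Y 0 ω) ^ 2 / 3) *
        Real.exp (-(l ^ 2 * v / 3))) ∂P :=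
          lintegral_mono fun ω => ENNReal.ofReal_le_ofReal (hle ω)
      _ = ENNReal.ofReal (∫ ω, (1 + l * Y 0 ω + (l * Y 0 ω) ^ 2 / 3) *
          Real.exp (-(l ^ 2 * v / 3)) ∂P) :=
          (ofReal_integral_eq_lintegral_ofReal hi
            (ae_of_all _ fun ω => (Real.exp_nonneg _).trans (hle ω))).symm
      _ = ENNReal.ofReal ((1 + l ^ 2 * v / 3) * Real.exp (-(l ^ 2 * v / 3))) := by
          rw [integral_mul_const]
          congr 2
          simp only [mul_pow]
          have hi1 : Integrable (fun ω => 1 + l * Y 0 ω) P :=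
            (integrable_const 1).add (hint.const_mul l)
          rw [integral_add hi1 ((hsq.const_mul (l ^ 2)).div_const 3),
            integral_add (integrable_const 1) (hint.const_mul l), integral_div,
            integral_const_mul, integral_const_mul, hmean]
          simp [hv]
      _ ≤ ENNReal.ofReal (Real.exp (l ^ 2 * v / 3) * Real.exp (-(l ^ 2 * v / 3))) := by
          gcongr
          linarith [Real.add_one_le_exp (l ^ 2 * v / 3)]
      _ = 1 := by rw [← Real.exp_add]; simp

lemma measure_mul_sum_ge_and_sumSq_le (hY : ∀ i, Measurable (Y i)) (hind : iIndepFun Y P)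
    (hid : ∀ i, IdentDistrib (Y i) (Y 0) P P) (hint : Integrable (Y 0) P)
    (hmean : ∫ ω, Y 0 ω ∂P = 0) (hsq : Integrable (fun ω => Y 0 ω ^ 2) P) (l c K : ℝ) (n : ℕ) :
    P {ω | c ≤ l * ∑ i ∈ Finset.range n, Y i ω ∧ ∑ i ∈ Finset.range n, Y i ω ^ 2 ≤ K} ≤
      ENNReal.ofReal (Real.exp (-c + l ^ 2 * (K + 2 * n * ∫ ω, Y 0 ω ^ 2 ∂P) / 6)) := by
  have h := measure_le_of_lintegral_exp_le (by fun_prop)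
    ((lintegral_exp_selfNormalized_le_one hY hind hid hint hmean hsq l n).trans_eq
      ENNReal.ofReal_one.symm) (c - l ^ 2 * (K + 2 * n * ∫ ω, Y 0 ω ^ 2 ∂P) / 6)
  refine (measure_mono ?_).trans (h.trans_eq ?_)
  · rintro ω ⟨h1, h2⟩
    have : l ^ 2 * ∑ i ∈ Finset.range n, Y i ω ^ 2 ≤ l ^ 2 * K := by gcongr
    simp only [Set.mem_ofPred_eq]
    linarith
  · rw [mul_one]
    congr 2
    ring

/-- The lower tail of a sum of squares: squares are nonnegative, so that moments of order slightly
above one already give an exponential bound. -/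
lemma measure_sumSq_le (hY : ∀ i, Measurable (Y i)) (hind : iIndepFun Y P)
    (hid : ∀ i, IdentDistrib (Y i) (Y 0) P P) (hsq : Integrable (fun ω => Y 0 ω ^ 2) P)
    {a m : ℝ} (ha : 0 < a) (ha1 : a ≤ 1) (hint : Integrable (fun ω => (Y 0 ω ^ 2) ^ (1 + a)) P)
    (hm : ∫ ω, (Y 0 ω ^ 2) ^ (1 + a) ∂P ≤ m) {t : ℝ} (ht : 0 ≤ t) (e : ℝ) (n : ℕ) :
    P {ω | ∑ i ∈ Finset.range n, Y i ω ^ 2 ≤ n * (∫ ω, Y 0 ω ^ 2 ∂P - e)} ≤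
      ENNReal.ofReal (Real.exp (-(n * (t * e - t ^ (1 + a) * m)))) := by
  have : IsProbabilityMeasure P := hind.isProbabilityMeasure
  set v := ∫ ω, Y 0 ω ^ 2 ∂P with hv
  have h := lintegral_exp_sum_le_one hY hind hid
    (g := fun y => -(t * y ^ 2) + (t * v - t ^ (1 + a) * m)) (by fun_prop) ?_ n
  · have h' := measure_le_of_lintegral_exp_le (by fun_prop) (h.trans_eq ENNReal.ofReal_one.symm)
      (n * (t * e - t ^ (1 + a) * m))
    rw [mul_one] at h'
    refine (measure_mono fun ω hω => ?_).trans h'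
    simp only [Set.mem_ofPred_eq] at hω ⊢
    rw [Finset.sum_add_distrib, Finset.sum_neg_distrib, ← Finset.mul_sum, Finset.sum_const,
      Finset.card_range, nsmul_eq_mul]
    have := mul_le_mul_of_nonneg_left hω ht
    linarith
  · have hi : Integrable (fun ω => (1 - t * Y 0 ω ^ 2 + t ^ (1 + a) * (Y 0 ω ^ 2) ^ (1 + a)) *
        Real.exp (t * v - t ^ (1 + a) * m)) P :=
      (((integrable_const 1).sub (hsq.const_mul t)).add (hint.const_mul _)).mul_const _
    have hle : ∀ ω, Real.exp (-(t * Y 0 ω ^ 2) + (t * v - t ^ (1 + a) * m)) ≤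
        (1 - t * Y 0 ω ^ 2 + t ^ (1 + a) * (Y 0 ω ^ 2) ^ (1 + a)) *
          Real.exp (t * v - t ^ (1 + a) * m) := fun ω => by
      rw [Real.exp_add, ← Real.mul_rpow ht (sq_nonneg _)]
      gcongr
      exact exp_neg_le_one_sub_add_rpow ha ha1 (by positivity)
    calc _ ≤ ∫⁻ ω, ENNReal.ofReal ((1 - t * Y 0 ω ^ 2 + t ^ (1 + a) * (Y 0 ω ^ 2) ^ (1 + a)) *
        Real.exp (t * v - t ^ (1 + a) * m)) ∂P :=
          lintegral_mono fun ω => ENNReal.ofReal_le_ofReal (hle ω)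
      _ = ENNReal.ofReal (∫ ω, (1 - t * Y 0 ω ^ 2 + t ^ (1 + a) * (Y 0 ω ^ 2) ^ (1 + a)) *
          Real.exp (t * v - t ^ (1 + a) * m) ∂P) :=
          (ofReal_integral_eq_lintegral_ofReal hi
            (ae_of_all _ fun ω => (Real.exp_nonneg _).trans (hle ω))).symm
      _ = ENNReal.ofReal ((1 - t * v + t ^ (1 + a) * ∫ ω, (Y 0 ω ^ 2) ^ (1 + a) ∂P) *
          Real.exp (t * v - t ^ (1 + a) * m)) := by
          rw [integral_mul_const]
          congr 2
          have hi1 : Integrable (fun ω => 1 - t * Y 0 ω ^ 2) P :=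
            (integrable_const 1).sub (hsq.const_mul t)
          rw [integral_add hi1 (hint.const_mul _),
            integral_sub (integrable_const 1) (hsq.const_mul t), integral_const_mul,
            integral_const_mul]
          simp [hv]
      _ ≤ ENNReal.ofReal (Real.exp (-(t * v - t ^ (1 + a) * m)) *
          Real.exp (t * v - t ^ (1 + a) * m)) := by
          gcongr
          have : t ^ (1 + a) * ∫ ω, (Y 0 ω ^ 2) ^ (1 + a) ∂P ≤ t ^ (1 + a) * m := by gcongr
          linarith [Real.add_one_le_exp (-(t * v - t ^ (1 + a) * m))]
      _ = 1 := by rw [← Real.exp_add]; simp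

lemma measure_exists_abs_gt_le (hid : ∀ i, IdentDistrib (Y i) (Y 0) P P)
    {p m b : ℝ} (hp : 0 ≤ p) (hb : 0 < b)
    (hm : ∫⁻ ω, ENNReal.ofReal (|Y 0 ω| ^ p) ∂P ≤ ENNReal.ofReal m) (n : ℕ) :
    P {ω | ∃ i ∈ Finset.range n, b < |Y i ω|} ≤ ENNReal.ofReal (n * (m * b ^ (-p))) := by
  have hbp : 0 < b ^ p := by positivity
  have h0 : P {ω | b < |Y 0 ω|} ≤ ENNReal.ofReal (m * b ^ (-p)) := by
    have h := meas_ge_le_lintegral_div (μ := P) (f := fun ω => ENNReal.ofReal (|Y 0 ω| ^ p))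
      (((hid 0).aemeasurable_fst.abs.pow_const p).ennreal_ofReal) (ε := ENNReal.ofReal (b ^ p))
      (by simpa using hbp) ENNReal.ofReal_ne_top
    refine (measure_mono fun ω hω => ?_).trans
      (h.trans ((ENNReal.div_le_div_right hm _).trans_eq ?_))
    · exact ENNReal.ofReal_le_ofReal (Real.rpow_le_rpow hb.le (le_of_lt hω) hp)
    · rw [← ENNReal.ofReal_div_of_pos hbp, Real.rpow_neg hb.le, div_eq_mul_inv]
  have hi : ∀ i, P {ω | b < |Y i ω|} = P {ω | b < |Y 0 ω|} := fun i =>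
    (hid i).measure_mem_eq (s := {y : ℝ | b < |y|})
      (measurableSet_lt measurable_const measurable_id.abs)
  have hU : {ω | ∃ i ∈ Finset.range n, b < |Y i ω|} =
      ⋃ i ∈ Finset.range n, {ω | b < |Y i ω|} := by ext; simp
  rw [hU]
  refine (measure_biUnion_finset_le _ _).trans ?_
  simp only [hi, Finset.sum_const, Finset.card_range, nsmul_eq_mul]
  rw [ENNReal.ofReal_mul (Nat.cast_nonneg n), ENNReal.ofReal_natCast]
  gcongr

end Iid

/-! ### Reduction to the exceptional event -/

section Reduction

variable {Ω : Type*} [MeasurableSpace Ω] {X : ℕ → Ω → ℝ}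

/-- The sum of squares `∑ (X_i - θ)²` around the true mean. -/
def centeredSumSq {Ω : Type*} (X : ℕ → Ω → ℝ) (θ : ℝ) (n : ℕ) (ω : Ω) : ℝ :=
  ∑ i ∈ Finset.range n, (X i ω - θ) ^ 2

@[fun_prop]
lemma measurable_centeredSum (hX : ∀ i, Measurable (X i)) (θ : ℝ) (n : ℕ) :
    Measurable (centeredSum X θ n) := by
  unfold centeredSum
  fun_prop

@[fun_prop]
lemma measurable_centeredSumSq (hX : ∀ i, Measurable (X i)) (θ : ℝ) (n : ℕ) :
    Measurable (centeredSumSq X θ n) := by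
  unfold centeredSumSq
  fun_prop

@[fun_prop]
lemma measurable_regVar (hX : ∀ i, Measurable (X i)) (n : ℕ) : Measurable (regVar X n) := by
  unfold regVar sampleVar sampleMean
  fun_prop

lemma measurable_rwsNormalMixture (hX : ∀ i, Measurable (X i)) (θ ρ C δ : ℝ) (n : ℕ) :
    Measurable (rwsNormalMixture X θ ρ C δ n) := by
  unfold rwsNormalMixture
  fun_prop

lemma rwsNormalMixture_nonneg {Ω : Type*} (X : ℕ → Ω → ℝ) (θ ρ δ : ℝ) {C : ℝ}
    (hC : 0 ≤ C) (n : ℕ) (ω : Ω) :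
    0 ≤ rwsNormalMixture X θ ρ C δ n ω := by
  unfold rwsNormalMixture
  exact le_min (by positivity) (by positivity)

lemma sampleVar_nonneg {Ω : Type*} (X : ℕ → Ω → ℝ) (n : ℕ) (ω : Ω) : 0 ≤ sampleVar X n ω := by
  unfold sampleVar
  positivity

lemma regVar_nonneg {Ω : Type*} (X : ℕ → Ω → ℝ) (n : ℕ) (ω : Ω) : 0 ≤ regVar X n ω := by
  have := sampleVar_nonneg X n ω
  have := Real.log_natCast_nonneg n
  unfold regVar
  positivity

/-- The identity `û_n = V_n² - S_n² / n + n / log n`. -/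
lemma regVar_eq {Ω : Type*} (X : ℕ → Ω → ℝ) (θ : ℝ) {n : ℕ} (hn : n ≠ 0) (ω : Ω) :
    regVar X n ω = centeredSumSq X θ n ω - centeredSum X θ n ω ^ 2 / n + n * (Real.log n)⁻¹ := by
  have hn' : (n : ℝ) ≠ 0 := Nat.cast_ne_zero.2 hn
  have h1 : ∑ i ∈ Finset.range n, X i ω = centeredSum X θ n ω + n * θ := by
    simp [centeredSum, Finset.sum_sub_distrib]
  have h2 : sampleMean X n ω = θ + centeredSum X θ n ω / n := by
    rw [sampleMean, h1]
    field_simp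
    ring
  have h3 : ∑ i ∈ Finset.range n, (X i ω - sampleMean X n ω) ^ 2 =
      centeredSumSq X θ n ω - centeredSum X θ n ω ^ 2 / n := by
    have : ∀ i, (X i ω - sampleMean X n ω) ^ 2 = (X i ω - θ) ^ 2 -
        2 * (centeredSum X θ n ω / n) * (X i ω - θ) + (centeredSum X θ n ω / n) ^ 2 := fun i => by
      rw [h2]; ring
    simp only [this]
    rw [Finset.sum_add_distrib, Finset.sum_sub_distrib, ← Finset.mul_sum, Finset.sum_const,
      Finset.card_range, nsmul_eq_mul]
    change centeredSumSq X θ n ω - 2 * (centeredSum X θ n ω / n) * centeredSum X θ n ω + _ = _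
    field_simp
    ring
  rw [regVar, sampleVar, h3]
  field_simp

lemma rwsNormalMixture_eq_min_integral {Ω : Type*} (X : ℕ → Ω → ℝ) (θ C δ : ℝ) {ρ : ℝ}
    (hρ : 0 < ρ) (n : ℕ) (ω : Ω) : rwsNormalMixture X θ ρ C δ n ω =
      min (∫ l, Real.exp (l * centeredSum X θ n ω - regVar X n ω * (l ^ 2 / 2))
        ∂(gaussianReal 0 ρ.toNNReal)) (C * (n : ℝ) ^ (δ * 0.24)) := by
  rw [integral_exp_gaussianReal hρ (regVar_nonneg X n ω), rwsNormalMixture]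

/-- Where `û_n` dominates `(V_n² + 2 n σ²) / 3`, the mixture is at most the mixture of the
self-normalized exponentials, whose expectation is at most one; elsewhere it is at most its
truncation level. -/
lemma lintegral_rwsNormalMixture_le (hX : ∀ i, Measurable (X i)) (θ δ C : ℝ) {ρ : ℝ} (hρ : 0 < ρ)
    {P : Measure Ω} (hind : iIndepFun (fun i ω => X i ω - θ) P)
    (hid : ∀ i, IdentDistrib (fun ω => X i ω - θ) (fun ω => X 0 ω - θ) P P)
    (hint : Integrable (fun ω => X 0 ω - θ) P) (hmean : ∫ ω, (X 0 ω - θ) ∂P = 0)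
    (hsq : Integrable (fun ω => (X 0 ω - θ) ^ 2) P) (n : ℕ) :
    ∫⁻ ω, ENNReal.ofReal (rwsNormalMixture X θ ρ C δ n ω) ∂P ≤
      1 + ENNReal.ofReal (C * (n : ℝ) ^ (δ * 0.24)) *
        P {ω | regVar X n ω <
          (centeredSumSq X θ n ω + 2 * n * ∫ ω, (X 0 ω - θ) ^ 2 ∂P) / 3} := by
  have : IsProbabilityMeasure P := hind.isProbabilityMeasure
  set v := ∫ ω, (X 0 ω - θ) ^ 2 ∂P with hv
  set B := {ω | regVar X n ω < (centeredSumSq X θ n ω + 2 * n * v) / 3} with hB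
  have hBm : MeasurableSet B := measurableSet_lt (by fun_prop) (by fun_prop)
  set T := ENNReal.ofReal (C * (n : ℝ) ^ (δ * 0.24)) with hT
  set G : Ω → ℝ → ℝ≥0∞ := fun ω l => ENNReal.ofReal (Real.exp (l * centeredSum X θ n ω -
    l ^ 2 * (centeredSumSq X θ n ω + 2 * n * v) / 6)) with hG
  have hGm : Measurable (Function.uncurry G) := by
    have h1 : Measurable fun z : Ω × ℝ => centeredSum X θ n z.1 :=
      (measurable_centeredSum hX θ n).comp measurable_fst
    have h2 : Measurable fun z : Ω × ℝ => centeredSumSq X θ n z.1 :=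
      (measurable_centeredSumSq hX θ n).comp measurable_fst
    simp only [hG, Function.uncurry_def]
    fun_prop
  have hpt : ∀ ω, ENNReal.ofReal (rwsNormalMixture X θ ρ C δ n ω) ≤
      (∫⁻ l, G ω l ∂(gaussianReal 0 ρ.toNNReal)) + B.indicator (fun _ => T) ω := by
    intro ω
    rw [rwsNormalMixture_eq_min_integral X θ C δ hρ]
    by_cases hω : ω ∈ B
    · rw [Set.indicator_of_mem hω]
      exact (ENNReal.ofReal_le_ofReal (min_le_right _ _)).trans le_add_self
    · rw [Set.indicator_of_notMem hω, add_zero]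
      refine (ENNReal.ofReal_le_ofReal (min_le_left _ _)).trans ?_
      rw [integral_eq_lintegral_of_nonneg_ae (ae_of_all _ fun _ => Real.exp_nonneg _)
        (by fun_prop)]
      refine ENNReal.ofReal_toReal_le.trans (lintegral_mono fun l => ?_)
      refine ENNReal.ofReal_le_ofReal (Real.exp_le_exp.2 ?_)
      have h1 : (centeredSumSq X θ n ω + 2 * n * v) / 3 ≤ regVar X n ω := not_lt.1 hω
      nlinarith [mul_le_mul_of_nonneg_right h1 (sq_nonneg l)]
  calc _ ≤ ∫⁻ ω, (∫⁻ l, G ω l ∂(gaussianReal 0 ρ.toNNReal)) + B.indicator (fun _ => T) ω ∂P :=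
        lintegral_mono hpt
    _ = ∫⁻ ω, ∫⁻ l, G ω l ∂(gaussianReal 0 ρ.toNNReal) ∂P + T * P B := by
        rw [lintegral_add_right _ (measurable_const.indicator hBm), lintegral_indicator_const hBm]
    _ = ∫⁻ l, ∫⁻ ω, G ω l ∂P ∂(gaussianReal 0 ρ.toNNReal) + T * P B := by
        rw [lintegral_lintegral_swap hGm.aemeasurable]
    _ ≤ ∫⁻ _, 1 ∂(gaussianReal 0 ρ.toNNReal) + T * P B := by
        gcongr with l
        exact lintegral_exp_selfNormalized_le_one (fun i => (hX i).sub_const θ) hind hid hint hmean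
          hsq l n
    _ = 1 + T * P B := by simp

end Reduction

/-! ### Probability of the exceptional event -/

lemma rpow_le_one_add_rpow {y q p : ℝ} (hy : 0 ≤ y) (hq : 0 ≤ q) (hqp : q ≤ p) :
    y ^ q ≤ 1 + y ^ p := by
  rcases le_total y 1 with h | h
  · have := Real.rpow_le_one hy h hq
    have := Real.rpow_nonneg hy p
    linarith
  · have := Real.rpow_le_rpow_of_exponent_le h hqp
    linarith

lemma integrable_and_integral_le_of_le_one_add {Ω : Type*} [MeasurableSpace Ω] {P : Measure Ω}
    [IsProbabilityMeasure P] {f g : Ω → ℝ} (hf : AEStronglyMeasurable f P) (hg : Integrable g P)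
    (h : ∀ ω, |f ω| ≤ 1 + g ω) : Integrable f P ∧ ∫ ω, f ω ∂P ≤ 1 + ∫ ω, g ω ∂P := by
  have hi : Integrable (fun ω => 1 + g ω) P := (integrable_const 1).add hg
  have hf' : Integrable f P := hi.mono' hf (ae_of_all _ h)
  refine ⟨hf', (integral_mono hf' hi fun ω => (le_abs_self _).trans (h ω)).trans_eq ?_⟩
  rw [integral_add (integrable_const 1) hg]
  simp

lemma integrable_of_integrable_abs_rpow {Ω : Type*} [MeasurableSpace Ω] {P : Measure Ω}
    [IsProbabilityMeasure P] {f : Ω → ℝ} (hf : AEStronglyMeasurable f P) {p : ℝ} (hp : 1 ≤ p)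
    (h : Integrable (fun ω => |f ω| ^ p) P) : Integrable f P :=
  (integrable_and_integral_le_of_le_one_add hf h fun ω => by
    simpa using rpow_le_one_add_rpow (abs_nonneg (f ω)) zero_le_one hp).1

lemma integrable_sq_and_integral_sq_le {Ω : Type*} [MeasurableSpace Ω] {P : Measure Ω}
    [IsProbabilityMeasure P] {f : Ω → ℝ} (hf : AEStronglyMeasurable f P) {p : ℝ} (hp : 2 ≤ p)
    (h : Integrable (fun ω => |f ω| ^ p) P) :
    Integrable (fun ω => f ω ^ 2) P ∧ ∫ ω, f ω ^ 2 ∂P ≤ 1 + ∫ ω, |f ω| ^ p ∂P :=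
  integrable_and_integral_le_of_le_one_add (hf.pow 2) h fun ω => by
    simpa using rpow_le_one_add_rpow (abs_nonneg (f ω)) zero_le_two hp

/-- The exponent of the truncation level `n ^ β` for the observations: `β < 1/2`, yet
`n * P(|X_0 - θ| > n ^ β) = O(n ^ (-δ/4))`. -/
noncomputable def truncExponent (δ : ℝ) : ℝ := (4 + δ) / (4 * (2 + δ))

/-- An upper bound for the probability that `û_n < (V_n² + 2 n σ²) / 3`, for laws whose centered
absolute moment of order `2 + δ` is at most `m`. The summands account for a small sum of squares
`V_n²`, for a large single observation, and for a large sum of moderate observations. -/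
noncomputable def exceptionalBound (δ m : ℝ) (n : ℕ) : ℝ :=
  Real.exp (-((n : ℝ) ^ (1 / 2 : ℝ) *
    ((Real.log n)⁻¹ - (n : ℝ) ^ (-(min (δ / 2) 1 / 2)) * (1 + m)))) +
  m * (n : ℝ) ^ (-(δ / 4)) +
  2 * Real.exp (-((n : ℝ) ^ (1 / 2 - truncExponent δ) * √((Real.log n)⁻¹ / 3)) +
    (1 + 2 * (1 + m)) / 6)

section Exceptional

variable {Ω : Type*} [MeasurableSpace Ω] {X : ℕ → Ω → ℝ}

/-- Since `û_n = V_n² - S_n² / n + n / log n`, the exceptional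
inequality means `V_n² < n σ² - (3/2) n / log n + (3/2) S_n² / n`. So either `V_n²` is below
`n (σ² - 1 / log n)`, or `S_n² / n` exceeds `n / (3 log n)`. In the latter case either some
observation is large or `V_n² ≤ n b²`. -/
lemma exceptional_subset {Ω : Type*} (X : ℕ → Ω → ℝ) (θ v b : ℝ) {n : ℕ} (hn : 2 ≤ n)
    {l : ℝ} (hl : 0 < l) :
    {ω | regVar X n ω < (centeredSumSq X θ n ω + 2 * n * v) / 3} ⊆
      {ω | centeredSumSq X θ n ω ≤ n * (v - (Real.log n)⁻¹)} ∪
      {ω | ∃ i ∈ Finset.range n, b < |X i ω - θ|} ∪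
      ({ω | l * (n * √((Real.log n)⁻¹ / 3)) ≤ l * centeredSum X θ n ω ∧
          centeredSumSq X θ n ω ≤ n * b ^ 2} ∪
        {ω | l * (n * √((Real.log n)⁻¹ / 3)) ≤ -l * centeredSum X θ n ω ∧
          centeredSumSq X θ n ω ≤ n * b ^ 2}) := by
  intro ω hω
  have hn0 : (0 : ℝ) < n := by positivity
  have he : 0 < (Real.log n)⁻¹ := inv_pos.2 (Real.log_pos (by exact_mod_cast hn))
  by_contra hcon
  simp only [Set.mem_union, Set.mem_ofPred_eq, not_or, not_le, not_exists, not_and,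
    not_lt] at hcon hω
  obtain ⟨⟨h1, h2⟩, h3, h4⟩ := hcon
  have hsq : centeredSumSq X θ n ω ≤ n * b ^ 2 := by
    calc centeredSumSq X θ n ω ≤ ∑ i ∈ Finset.range n, b ^ 2 :=
          Finset.sum_le_sum fun i hi => sq_le_sq' (by linarith [abs_le.1 (h2 i hi)])
            (abs_le.1 (h2 i hi)).2
      _ = n * b ^ 2 := by simp
  have h5 : centeredSum X θ n ω < n * √((Real.log n)⁻¹ / 3) := by
    by_contra! h
    exact absurd (h3 (by gcongr)) (not_lt.2 hsq)
  have h6 : -centeredSum X θ n ω < n * √((Real.log n)⁻¹ / 3) := by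
    by_contra! h
    refine absurd (h4 ?_) (not_lt.2 hsq)
    rw [neg_mul, ← mul_neg]
    gcongr
  have h7 : centeredSum X θ n ω ^ 2 ≤ n ^ 2 * ((Real.log n)⁻¹ / 3) := by
    calc centeredSum X θ n ω ^ 2 ≤ (n * √((Real.log n)⁻¹ / 3)) ^ 2 :=
          sq_le_sq' (by linarith) h5.le
      _ = _ := by rw [mul_pow, Real.sq_sqrt (by positivity)]
  have h8 : centeredSum X θ n ω ^ 2 / n ≤ n * ((Real.log n)⁻¹ / 3) := by
    rw [div_le_iff₀ hn0]
    linarith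
  rw [regVar_eq X θ (by omega)] at hω
  linarith

lemma measure_exceptional_le (hX : ∀ i, Measurable (X i)) (θ : ℝ) {δ m : ℝ} (hδ : 0 < δ)
    (hm0 : 0 ≤ m) {P : Measure Ω} (hind : iIndepFun (fun i ω => X i ω - θ) P)
    (hid : ∀ i, IdentDistrib (fun ω => X i ω - θ) (fun ω => X 0 ω - θ) P P)
    (hint : Integrable (fun ω => |X 0 ω - θ| ^ (2 + δ)) P)
    (hm : ∫ ω, |X 0 ω - θ| ^ (2 + δ) ∂P ≤ m)
    (hmean : ∫ ω, (X 0 ω - θ) ∂P = 0) {n : ℕ} (hn : 2 ≤ n) :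
    P {ω | regVar X n ω < (centeredSumSq X θ n ω + 2 * n * ∫ ω, (X 0 ω - θ) ^ 2 ∂P) / 3} ≤
      ENNReal.ofReal (exceptionalBound δ m n) := by
  have : IsProbabilityMeasure P := hind.isProbabilityMeasure
  have hX0 := hX 0
  have hn0 : (0 : ℝ) < n := by positivity
  have hY : ∀ i, Measurable (fun ω => X i ω - θ) := fun i => (hX i).sub_const θ
  have hint1 := integrable_of_integrable_abs_rpow (hY 0).aestronglyMeasurable (by linarith) hint
  obtain ⟨hsq, hsqm⟩ := integrable_sq_and_integral_sq_le (hY 0).aestronglyMeasurable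
    (by linarith) hint
  set a := min (δ / 2) 1 with ha_def
  have ha : 0 < a := by positivity
  have ha1 : a ≤ 1 := min_le_right _ _
  have ha2 : a ≤ δ / 2 := min_le_left _ _
  obtain ⟨hqi, hqm⟩ := integrable_and_integral_le_of_le_one_add
    (f := fun ω => ((X 0 ω - θ) ^ 2) ^ (1 + a))
    (by fun_prop : Measurable _).aestronglyMeasurable hint fun ω => by
      have h := rpow_le_one_add_rpow (abs_nonneg (X 0 ω - θ))
        (by positivity : 0 ≤ 2 * (1 + a)) (by linarith : 2 * (1 + a) ≤ 2 + δ)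
      rwa [Real.rpow_mul (abs_nonneg _), Real.rpow_two, sq_abs, ← abs_of_nonneg
        (by positivity : 0 ≤ ((X 0 ω - θ) ^ 2) ^ (1 + a))] at h
  have hmL : ∫⁻ ω, ENNReal.ofReal (|X 0 ω - θ| ^ (2 + δ)) ∂P ≤ ENNReal.ofReal m := by
    rw [← ofReal_integral_eq_lintegral_ofReal hint (ae_of_all _ fun ω => by positivity)]
    exact ENNReal.ofReal_le_ofReal hm
  set β := truncExponent δ with hβ
  have hβ0 : 0 < β := by rw [hβ, truncExponent]; positivity
  -- `l` is of the order at which `l² V_n² ≤ l² n (n ^ β)²` stays bounded.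
  set l : ℝ := (n : ℝ) ^ (-(1 / 2 + β)) with hl_def
  have hl : 0 < l := by positivity
  -- With `t = n ^ (-1/2)` the main term `n t / log n` beats `n t ^ (1 + a)`.
  have hlow := measure_sumSq_le hY hind hid hsq ha ha1 hqi (hqm.trans (by gcongr))
    (t := (n : ℝ) ^ (-(1 / 2) : ℝ)) (by positivity) (Real.log n)⁻¹ n (m := 1 + m)
  have hlarge := measure_exists_abs_gt_le hid (by positivity : 0 ≤ 2 + δ)
    (b := (n : ℝ) ^ β) (by positivity) hmL n
  set c := l * (n * √((Real.log n)⁻¹ / 3)) with hc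
  have hup := measure_mul_sum_ge_and_sumSq_le hY hind hid hint1 hmean hsq l c
    (n * ((n : ℝ) ^ β) ^ 2) n
  have hdown := measure_mul_sum_ge_and_sumSq_le hY hind hid hint1 hmean hsq (-l) c
    (n * ((n : ℝ) ^ β) ^ 2) n
  rw [neg_sq] at hdown
  set v := ∫ ω, (X 0 ω - θ) ^ 2 ∂P with hv
  have e1 : Real.exp (-(n * ((n : ℝ) ^ (-(1 / 2) : ℝ) * (Real.log n)⁻¹ -
      ((n : ℝ) ^ (-(1 / 2) : ℝ)) ^ (1 + a) * (1 + m)))) = Real.exp (-((n : ℝ) ^ (1 / 2 : ℝ) *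
        ((Real.log n)⁻¹ - (n : ℝ) ^ (-(a / 2)) * (1 + m)))) := by
    have i1 : (n : ℝ) ^ (1 / 2 : ℝ) = n * (n : ℝ) ^ (-(1 / 2) : ℝ) := by
      rw [← Real.rpow_one_add' hn0.le (by norm_num)]
      norm_num
    have i2 : ((n : ℝ) ^ (-(1 / 2) : ℝ)) ^ (1 + a) =
        (n : ℝ) ^ (-(1 / 2) : ℝ) * (n : ℝ) ^ (-(a / 2)) := by
      rw [← Real.rpow_mul hn0.le, ← Real.rpow_add hn0]
      ring_nf
    rw [i1, i2]
    ring_nf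
  have e2 : n * (m * ((n : ℝ) ^ β) ^ (-(2 + δ))) = m * (n : ℝ) ^ (-(δ / 4)) := by
    have i1 : (n : ℝ) ^ (-(δ / 4)) = n * (n : ℝ) ^ (β * (-(2 + δ))) := by
      rw [mul_comm (n : ℝ), ← Real.rpow_add_one hn0.ne']
      congr 1
      rw [hβ, truncExponent]
      field_simp
      ring
    rw [i1, Real.rpow_mul hn0.le]
    ring
  have e3 : c = (n : ℝ) ^ (1 / 2 - β) * √((Real.log n)⁻¹ / 3) := by
    have : (n : ℝ) ^ (1 / 2 - β) = l * n := by
      rw [hl_def, ← Real.rpow_add_one hn0.ne']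
      ring_nf
    rw [this, hc]
    ring
  have e4 : l ^ 2 * (n * ((n : ℝ) ^ β) ^ 2 + 2 * n * v) / 6 ≤ (1 + 2 * (1 + m)) / 6 := by
    have i1 : l ^ 2 * (n * ((n : ℝ) ^ β) ^ 2) = 1 := by
      have : l = (n : ℝ) ^ (-(1 / 2) : ℝ) * ((n : ℝ) ^ β)⁻¹ := by
        rw [hl_def, neg_add, Real.rpow_add hn0, Real.rpow_neg hn0.le β]
      have i2 : ((n : ℝ) ^ (-(1 / 2) : ℝ)) ^ 2 * n = 1 := by
        rw [← Real.rpow_natCast, ← Real.rpow_mul hn0.le, ← Real.rpow_add_one hn0.ne']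
        norm_num
      rw [this, mul_pow]
      have : (n : ℝ) ^ β ≠ 0 := by positivity
      calc _ = (((n : ℝ) ^ (-(1 / 2) : ℝ)) ^ 2 * n) * ((((n : ℝ) ^ β)⁻¹) * (n : ℝ) ^ β) ^ 2 := by
            ring
        _ = 1 := by rw [i2, inv_mul_cancel₀ this]; norm_num
    have i3 : l ^ 2 * n ≤ 1 := by
      have h1n : 1 ≤ (n : ℝ) ^ β := Real.one_le_rpow (by exact_mod_cast (by omega : 1 ≤ n)) hβ0.le
      calc l ^ 2 * n = l ^ 2 * (n * 1 ^ 2) := by ring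
        _ ≤ l ^ 2 * (n * ((n : ℝ) ^ β) ^ 2) := by gcongr
        _ = 1 := i1
    have i4 : v ≤ 1 + m := hsqm.trans (by gcongr)
    have i5 : l ^ 2 * n * v ≤ 1 * (1 + m) := by
      gcongr
    linarith
  rw [e1] at hlow
  rw [e2] at hlarge
  have hE : Real.exp (-c + l ^ 2 * (n * ((n : ℝ) ^ β) ^ 2 + 2 * n * v) / 6) ≤
      Real.exp (-((n : ℝ) ^ (1 / 2 - β) * √((Real.log n)⁻¹ / 3)) + (1 + 2 * (1 + m)) / 6) := by
    rw [← e3]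
    gcongr
  refine (measure_mono (exceptional_subset X θ v ((n : ℝ) ^ β) hn hl)).trans ?_
  refine (measure_union_le _ _).trans ((add_le_add (measure_union_le _ _)
    (measure_union_le _ _)).trans ?_)
  refine (add_le_add (add_le_add hlow hlarge)
    (add_le_add (hup.trans (ENNReal.ofReal_le_ofReal hE))
      (hdown.trans (ENNReal.ofReal_le_ofReal hE)))).trans_eq ?_
  rw [← ENNReal.ofReal_add (by positivity) (by positivity),
    ← ENNReal.ofReal_add (by positivity) (by positivity),
    ← ENNReal.ofReal_add (by positivity) (by positivity), exceptionalBound, two_mul (Real.exp _)]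

end Exceptional

/-! ### The truncated exceptional event is negligible -/

lemma tendsto_rpow_mul_exp_neg_of_le {f : ℝ → ℝ} {d : ℝ} (hd : 0 < d) (k : ℝ)
    (hf : ∀ᶠ x in atTop, x ^ d ≤ f x) :
    Tendsto (fun x : ℝ => x ^ k * Real.exp (-f x)) atTop (nhds 0) := by
  have h := (tendsto_rpow_mul_exp_neg_mul_atTop_nhds_zero (k / d) 1 one_pos).comp
    (tendsto_rpow_atTop hd)
  refine squeeze_zero' ?_ ?_ h
  · filter_upwards [eventually_ge_atTop 0] with x hx
    positivity
  · filter_upwards [eventually_ge_atTop 0, hf] with x hx hfx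
    simp only [Function.comp_apply]
    rw [← Real.rpow_mul hx, mul_div_cancel₀ _ hd.ne']
    gcongr
    linarith

lemma tendsto_log_mul_rpow_neg {s : ℝ} (hs : 0 < s) :
    Tendsto (fun x : ℝ => Real.log x * x ^ (-s)) atTop (nhds 0) := by
  refine (isLittleO_log_rpow_atTop hs).tendsto_div_nhds_zero.congr' ?_
  filter_upwards [eventually_ge_atTop 0] with x hx
  rw [Real.rpow_neg hx, div_eq_mul_inv]

lemma eventually_rpow_le_lowerTailExponent {a : ℝ} (ha : 0 < a) (m : ℝ) :
    ∀ᶠ x : ℝ in atTop, x ^ (1 / 4 : ℝ) ≤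
      x ^ (1 / 2 : ℝ) * ((Real.log x)⁻¹ - x ^ (-(a / 2)) * m) := by
  have h : Tendsto (fun x : ℝ => Real.log x * x ^ (-(1 / 4) : ℝ) +
      Real.log x * x ^ (-(a / 2)) * m) atTop (nhds (0 + 0 * m)) :=
    (tendsto_log_mul_rpow_neg (by norm_num)).add
      ((tendsto_log_mul_rpow_neg (by positivity)).mul_const m)
  rw [zero_mul, add_zero] at h
  filter_upwards [h.eventually_le_const one_pos, eventually_gt_atTop 1] with x hx hx1
  have hx0 : 0 < x := by linarith
  have hl : 0 < Real.log x := Real.log_pos hx1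
  have e : x ^ (1 / 4 : ℝ) = x ^ (1 / 2 : ℝ) * x ^ (-(1 / 4) : ℝ) := by
    rw [← Real.rpow_add hx0]
    norm_num
  rw [e]
  gcongr
  rw [le_sub_iff_add_le, ← one_div, le_div_iff₀ hl]
  linarith

lemma eventually_rpow_le_rpow_mul_sqrt {g : ℝ} (hg : 0 < g) :
    ∀ᶠ x : ℝ in atTop, x ^ (g / 2) ≤ x ^ g * √((Real.log x)⁻¹ / 3) := by
  filter_upwards [(tendsto_log_mul_rpow_neg hg).eventually_le_const
    (by norm_num : (0 : ℝ) < 1 / 3), eventually_gt_atTop 1] with x hx hx1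
  have hx0 : 0 < x := by linarith
  have hl : 0 < Real.log x := Real.log_pos hx1
  have e : x ^ (g / 2) = x ^ g * x ^ (-(g / 2)) := by
    rw [← Real.rpow_add hx0]
    ring_nf
  rw [e]
  gcongr
  refine Real.le_sqrt_of_sq_le ?_
  have e2 : (x ^ (-(g / 2))) ^ 2 = x ^ (-g) := by
    rw [← Real.rpow_natCast, ← Real.rpow_mul hx0.le]
    congr 1
    push_cast
    ring
  rw [e2, le_div_iff₀ (by norm_num), ← one_div, le_div_iff₀ hl]
  linarith

/-- The large-observation term decays like `n ^ (-δ/4)`, just faster than the truncation level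
`n ^ (0.24 δ)` grows; the other two terms decay faster than any power of `n`. -/
lemma tendsto_truncation_mul_exceptionalBound {δ : ℝ} (hδ : 0 < δ) (C m : ℝ) :
    Tendsto (fun n : ℕ => C * (n : ℝ) ^ (δ * 0.24) * exceptionalBound δ m n) atTop (nhds 0) := by
  have h1 := (tendsto_rpow_mul_exp_neg_of_le (by norm_num) (δ * 0.24)
    (eventually_rpow_le_lowerTailExponent (by positivity : 0 < min (δ / 2) 1)
      (1 + m))).comp (tendsto_natCast_atTop_atTop (R := ℝ))
  have hg : 0 < 1 / 2 - truncExponent δ := by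
    have : 1 / 2 - truncExponent δ = δ / (4 * (2 + δ)) := by
      rw [truncExponent]
      field_simp
      ring
    rw [this]
    positivity
  have h3 := (tendsto_rpow_mul_exp_neg_of_le (half_pos hg) (δ * 0.24)
    (eventually_rpow_le_rpow_mul_sqrt hg)).comp (tendsto_natCast_atTop_atTop (R := ℝ))
  have h2 := (tendsto_rpow_neg_atTop (by positivity : 0 < 0.01 * δ)).comp
    (tendsto_natCast_atTop_atTop (R := ℝ))
  have h := ((h1.const_mul C).add (h2.const_mul (C * m))).add
    (h3.const_mul (C * 2 * Real.exp ((1 + 2 * (1 + m)) / 6)))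
  simp only [mul_zero, add_zero] at h
  refine h.congr' ?_
  filter_upwards [eventually_gt_atTop 0] with n hn
  have hn0 : (0 : ℝ) < n := by exact_mod_cast hn
  have e : (n : ℝ) ^ (-(0.01 * δ)) = (n : ℝ) ^ (δ * 0.24) * (n : ℝ) ^ (-(δ / 4)) := by
    rw [← Real.rpow_add hn0]
    ring_nf
  simp only [Function.comp_apply, exceptionalBound, Real.exp_add, e]
  ring

/-! ### Moments around the mean and around zero -/

lemma lintegral_abs_rpow_sub_le {Ω : Type*} [MeasurableSpace Ω] (P : Measure Ω)
    [IsProbabilityMeasure P] {f : Ω → ℝ} (hf : Measurable f) {p : ℝ} (hp : 0 ≤ p) (c : ℝ) :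
    ∫⁻ ω, ENNReal.ofReal (|f ω - c| ^ p) ∂P ≤ ENNReal.ofReal (2 ^ p) *
      (∫⁻ ω, ENNReal.ofReal (|f ω| ^ p) ∂P + ENNReal.ofReal (|c| ^ p)) := by
  have hpt : ∀ x y : ℝ, |x - y| ^ p ≤ 2 ^ p * (|x| ^ p + |y| ^ p) := fun x y => by
    have h1 : |x - y| ≤ 2 * max |x| |y| := by
      linarith [abs_sub x y, le_max_left |x| |y|, le_max_right |x| |y|]
    have h2 : (max |x| |y|) ^ p ≤ |x| ^ p + |y| ^ p := by
      rcases max_choice |x| |y| with h | h <;> rw [h] <;>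
        linarith [Real.rpow_nonneg (abs_nonneg x) p, Real.rpow_nonneg (abs_nonneg y) p]
    calc |x - y| ^ p ≤ (2 * max |x| |y|) ^ p := by gcongr
      _ = 2 ^ p * (max |x| |y|) ^ p := Real.mul_rpow (by norm_num) (by positivity)
      _ ≤ _ := by gcongr
  calc _ ≤ ∫⁻ ω, ENNReal.ofReal (2 ^ p) *
        (ENNReal.ofReal (|f ω| ^ p) + ENNReal.ofReal (|c| ^ p)) ∂P := by
        refine lintegral_mono fun ω => (ENNReal.ofReal_le_ofReal (hpt _ _)).trans_eq ?_
        rw [ENNReal.ofReal_mul (by positivity), ENNReal.ofReal_add (by positivity) (by positivity)]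
    _ = _ := by
        rw [lintegral_const_mul _ (by fun_prop), lintegral_add_right _ measurable_const]
        simp

/-! ### Uniform bound over the moment class -/

section Uniform

variable {Ω : Type*} [MeasurableSpace Ω] {X : ℕ → Ω → ℝ}

lemma lintegral_rwsNormalMixture_le_of_mem_iidLaws (hX : ∀ i, Measurable (X i)) {θ δ C ρ : ℝ}
    (hδ : 0 < δ) (hC : 0 < C) (hρ : 0 < ρ) {P : Measure Ω}
    (hP : P ∈ iidLaws X (momentClass (2 + δ) θ)) {m : ℝ} (hm0 : 0 ≤ m)
    (hm : ∫⁻ ω, ENNReal.ofReal (|X 0 ω - θ| ^ (2 + δ)) ∂P ≤ ENNReal.ofReal m) {n : ℕ}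
    (hn : 2 ≤ n) :
    ∫⁻ ω, ENNReal.ofReal (rwsNormalMixture X θ ρ C δ n ω) ∂P ≤
      1 + ENNReal.ofReal (C * (n : ℝ) ^ (δ * 0.24) * exceptionalBound δ m n) := by
  obtain ⟨hprob, hind, hid, -, hint, hmean⟩ := hP
  have hX0 := hX 0
  have hg : Measurable fun x : ℝ => |x - θ| ^ (2 + δ) := by fun_prop
  rw [integrable_map_measure hg.aestronglyMeasurable hX0.aemeasurable] at hint
  rw [integral_map hX0.aemeasurable (by fun_prop)] at hmean
  have hind' : iIndepFun (fun i ω => X i ω - θ) P :=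
    hind.comp (fun _ x => x - θ) fun _ => by fun_prop
  have hid' : ∀ i, IdentDistrib (fun ω => X i ω - θ) (fun ω => X 0 ω - θ) P P := fun i =>
    (hid i).comp (u := fun x => x - θ) (by fun_prop)
  change Integrable (fun ω => |X 0 ω - θ| ^ (2 + δ)) P at hint
  have hm' : ∫ ω, |X 0 ω - θ| ^ (2 + δ) ∂P ≤ m := by
    rw [integral_eq_lintegral_of_nonneg_ae (ae_of_all _ fun ω => by positivity)
      hint.aestronglyMeasurable]
    exact ENNReal.toReal_le_of_le_ofReal hm0 hm
  have hint1 : Integrable (fun ω => X 0 ω - θ) P :=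
    integrable_of_integrable_abs_rpow (by fun_prop) (by linarith) hint
  have hsq : Integrable (fun ω => (X 0 ω - θ) ^ 2) P :=
    (integrable_sq_and_integral_sq_le (by fun_prop) (by linarith) hint).1
  have hmean' : ∫ ω, (X 0 ω - θ) ∂P = 0 := by
    have hX0i : Integrable (X 0) P := by
      simpa [Pi.add_def] using hint1.add (integrable_const θ)
    rw [integral_sub hX0i (integrable_const θ), hmean]
    simp
  refine (lintegral_rwsNormalMixture_le hX θ δ C hρ hind' hid' hint1 hmean' hsq n).trans ?_
  rw [ENNReal.ofReal_mul (by positivity : 0 ≤ C * (n : ℝ) ^ (δ * 0.24))]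
  gcongr
  exact measure_exceptional_le hX θ hδ hm0 hind' hid' hint hm' hmean' hn

lemma isUniformAsymptoticEVariable_rwsNormalMixture (hX : ∀ i, Measurable (X i)) {θ δ C ρ : ℝ}
    (hδ : 0 < δ) (hC : 0 < C) (hρ : 0 < ρ) {Ps : Set (Measure Ω)}
    (hPs : Ps ⊆ iidLaws X (momentClass (2 + δ) θ))
    (hb : UniformlyBoundedMoment Ps (X 0) (2 + δ)) :
    IsUniformAsymptoticEVariable Ps (rwsNormalMixture X θ ρ C δ) := by
  refine ⟨measurable_rwsNormalMixture hX θ ρ C δ, rwsNormalMixture_nonneg X θ ρ δ hC.le, ?_⟩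
  set K := ⨆ P ∈ Ps, ∫⁻ ω, ENNReal.ofReal (|X 0 ω| ^ (2 + δ)) ∂P with hK
  set M := ENNReal.ofReal (2 ^ (2 + δ)) * (K + ENNReal.ofReal (|θ| ^ (2 + δ))) with hM
  have hMtop : M ≠ ∞ := ENNReal.mul_ne_top ENNReal.ofReal_ne_top
    (ENNReal.add_ne_top.2 ⟨hb.ne, ENNReal.ofReal_ne_top⟩)
  have hlim : Tendsto (fun n : ℕ => 1 + ENNReal.ofReal
      (C * (n : ℝ) ^ (δ * 0.24) * exceptionalBound δ M.toReal n)) atTop (nhds 1) := by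
    simpa using (ENNReal.tendsto_ofReal
      (tendsto_truncation_mul_exceptionalBound hδ C M.toReal)).const_add 1
  rw [← hlim.limsup_eq]
  refine limsup_le_limsup ?_
  filter_upwards [eventually_ge_atTop 2] with n hn
  refine iSup₂_le fun P hP => ?_
  have : IsProbabilityMeasure P := (hPs hP).1
  refine lintegral_rwsNormalMixture_le_of_mem_iidLaws hX hδ hC hρ (hPs hP) ENNReal.toReal_nonneg
    ?_ hn
  rw [ENNReal.ofReal_toReal hMtop]
  refine (lintegral_abs_rpow_sub_le P (hX 0) (by positivity) θ).trans ?_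
  rw [hM]
  gcongr
  exact le_iSup₂ (f := fun (P : Measure Ω) (_ : P ∈ Ps) =>
    ∫⁻ ω, ENNReal.ofReal (|X 0 ω| ^ (2 + δ)) ∂P) P hP

/-- A law of the moment class has a finite moment around zero, so that the uniform statement
applies to the class that consists of this law alone. -/
lemma uniformlyBoundedMoment_singleton (hX : ∀ i, Measurable (X i)) {θ δ : ℝ} (hδ : 0 < δ)
    {P : Measure Ω} (hP : P ∈ iidLaws X (momentClass (2 + δ) θ)) :
    UniformlyBoundedMoment {P} (X 0) (2 + δ) := by
  obtain ⟨hprob, -, -, -, hint, -⟩ := hP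
  have hX0 := hX 0
  have hg : Measurable fun x : ℝ => |x - θ| ^ (2 + δ) := by fun_prop
  rw [integrable_map_measure hg.aestronglyMeasurable hX0.aemeasurable] at hint
  rw [UniformlyBoundedMoment, iSup_singleton]
  have h := lintegral_abs_rpow_sub_le P (hX0.sub_const θ) (by positivity : 0 ≤ 2 + δ) (-θ)
  simp only [sub_neg_eq_add, sub_add_cancel] at h
  refine h.trans_lt (ENNReal.mul_lt_top ENNReal.ofReal_lt_top
    (ENNReal.add_lt_top.2 ⟨?_, ENNReal.ofReal_lt_top⟩))
  exact hint.lintegral_lt_top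

end Uniform

theorem corollary2 {Ω : Type*} [MeasurableSpace Ω] (X : ℕ → Ω → ℝ) (hX : ∀ i, Measurable (X i))
    (θ δ C ρ : ℝ) (hδ : 0 < δ) (hC : 0 < C) (hρ : 0 < ρ) :
    -- the closed form is the mixture over a centered Gaussian with variance `ρ`
    (∀ n : ℕ, 2 ≤ n → ∀ ω : Ω,
      rwsNormalMixture X θ ρ C δ n ω =
        rwsMixture X θ (gaussianReal 0 ρ.toNNReal) (fun k => 1 / Real.log k)
          (fun k => C * (k : ℝ) ^ (δ * 0.24)) n ω) ∧
    -- pointwise claim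
    IsAsymptoticEVariable (iidLaws X (momentClass (2 + δ) θ)) (rwsNormalMixture X θ ρ C δ) ∧
    -- distribution-uniform claim
    (∀ Ps : Set (Measure Ω), Ps ⊆ iidLaws X (momentClass (2 + δ) θ) →
      UniformlyBoundedMoment Ps (X 0) (2 + δ) →
      IsUniformAsymptoticEVariable Ps (rwsNormalMixture X θ ρ C δ)) := by
  refine ⟨fun n _ ω => ?_, ⟨measurable_rwsNormalMixture hX θ ρ C δ,
    rwsNormalMixture_nonneg X θ ρ δ hC.le, iSup₂_le fun P hP => ?_⟩, fun Ps hPs hb =>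
      isUniformAsymptoticEVariable_rwsNormalMixture hX hδ hC hρ hPs hb⟩
  · rw [rwsNormalMixture_eq_min_integral X θ C δ hρ]
    simp only [rwsMixture, regVar, one_div]
  · have h := (isUniformAsymptoticEVariable_rwsNormalMixture hX hδ hC hρ
      (Set.singleton_subset_iff.2 hP) (uniformlyBoundedMoment_singleton hX hδ hP)).2.2
    simpa only [iSup_singleton] using h
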